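/- Let $K$ be a field, $R = K[x_1,\dots,x_n]$, and let $I \subset R$ be an ideal generated by monomials. Assume that $I$ has no embedded associated primes, that every $\mathfrak p \in \operatorname{Ass}(R/I)$ has height $2$, and that the irreducible decomposition of $I$ is minimal, that is, $I = \mathfrak q_1 \cap \dots \cap \mathfrak q_r$ with no $\mathfrak q_j$ redundant, where each $\mathfrak q_j$ is an irreducible monomial ideal (a proper ideal that is not the intersection of two strictly larger ideals; equivalently $\mathfrak q_j = \langle x_i^{w_{j,i}} : i \in A_j \rangle$ with $\emptyset\neq A_j \subset [n]$ and integers $w_{j,i} \ge 1$, or $\mathfrak q_j=0$) and the radicals $\sqrt{\mathfrak q_1}, \dots, \sqrt{\mathfrak q_r}$ are pairwise distinct. Let $\mathcal H_I$ be the hypergraph on $[n] = \{1,\dots,n\}$ whose edges are the sets $A \subset [n]$ for which $\langle x_i : i \in A\rangle$ is a minimal prime of $I$; it is the unique hypergraph without edges contained in one another whose cover ideal $\bigcap_{A} \langle x_i : i \in A\rangle$ (intersection over the edges $A$) equals $\sqrt I$. For $s \ge 1$ let $I^{(s)} = \bigcap_{\mathfrak p \in \operatorname{Ass}(R/I)}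 (I^s R_{\mathfrak p} \cap R)$ be the $s$-th symbolic power of $I$; $I$ is called a Simis ideal if $I^{(s)} = I^s$ for all $s \ge 1$. Say that $I$ has a standard linear weighting if there are an ideal $J \subset R$ generated by squarefree monomials and positive integers $w_1,\dots,w_n$ such that $I = J_w := \langle x_1^{w_1a_1}\cdots x_n^{w_na_n} : x_1^{a_1}\cdots x_n^{a_n} \in J\rangle$. Then every edge of $\mathcal H_I$ has exactly two elements, so that $\mathcal H_I$ is a graph, denoted $G_I$, and the following conditions are equivalent: (i) $I$ is a Simis ideal; (ii) $I^{(2)} = I^2$; (iii) $G_I$ is a bipartite graph and $I$ has a standard linear weighting. -/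

import Mathlib

namespace SimisIdeals

open MvPolynomial

/-! ### Symbolic powers and associated primes -/

section General

variable {R : Type*} [CommRing R]

/-- The `s`-th symbolic power `I^(s) = ⋂_{p ∈ Ass(I)} (I^s R_p ∩ R)`, where `Ass(I)` is the set of
associated primes of the `R`-module `R ⧸ I`. -/
def symbolicPower (I : Ideal R) (s : ℕ) : Ideal R :=
  ⨅ p : associatedPrimes R (R ⧸ I),
    ((I ^ s).map (algebraMap R (Localization.AtPrime p.1))).comap
      (algebraMap R (Localization.AtPrime p.1))

/-- `I` is a Simis ideal if `I^(s) = I^s` for all `s ≥ 1`. -/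
def IsSimis (I : Ideal R) : Prop :=
  ∀ s : ℕ, 1 ≤ s → symbolicPower I s = I ^ s

/-- An associated prime of `I` is embedded if it properly contains another associated prime
of `I`. -/
def IsEmbeddedPrime (I p : Ideal R) : Prop :=
  p ∈ associatedPrimes R (R ⧸ I) ∧ ∃ q ∈ associatedPrimes R (R ⧸ I), q < p

end General

/-! ### Monomial ideals and weightings -/

section Monomial

variable {K : Type*} [Field K] {n : ℕ}

/-- A monomial ideal of `K[x_1, …, x_n]`: an ideal generated by monomials. -/
def IsMonomialIdeal (I : Ideal (MvPolynomial (Fin n) K)) : Prop :=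
  ∃ S : Set (Fin n →₀ ℕ), I = Ideal.span ((fun a => monomial a (1 : K)) '' S)

/-- A squarefree monomial ideal: an ideal generated by squarefree monomials. -/
def IsSquarefreeMonomialIdeal (I : Ideal (MvPolynomial (Fin n) K)) : Prop :=
  ∃ S : Set (Fin n →₀ ℕ), (∀ a ∈ S, ∀ i, a i ≤ 1) ∧
    I = Ideal.span ((fun a => monomial a (1 : K)) '' S)

/-- The exponent vector `w(a) = (w_1 a_1, …, w_n a_n)`. -/
noncomputable def weightExponent (w : Fin n → ℕ) (a : Fin n →₀ ℕ) : Fin n →₀ ℕ :=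
  Finsupp.equivFunOnFinite.symm fun i => w i * a i

/-- The weighted monomial ideal `J_w = ⟨x^{w(a)} : x^a ∈ J⟩` for `w = (w_1, …, w_n)`. -/
noncomputable def weightedIdeal (w : Fin n → ℕ) (J : Ideal (MvPolynomial (Fin n) K)) :
    Ideal (MvPolynomial (Fin n) K) :=
  Ideal.span ((fun a => monomial (weightExponent w a) (1 : K)) '' {a | monomial a (1 : K) ∈ J})

/-- `I` has a standard linear weighting: `I = J_w` for a squarefree monomial ideal `J` and positive
integers `w_1, …, w_n`. -/
def HasStandardLinearWeighting (I : Ideal (MvPolynomial (Fin n) K)) : Prop :=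
  ∃ (J : Ideal (MvPolynomial (Fin n) K)) (w : Fin n → ℕ),
    IsSquarefreeMonomialIdeal J ∧ (∀ i, 0 < w i) ∧ I = weightedIdeal w J

/-- The irreducible decomposition of `I` is minimal: `I` has a minimal primary decomposition (no
redundant component, pairwise distinct radicals) whose components are irreducible monomial ideals.
Here an ideal is irreducible if it is proper and is not the intersection of two strictly larger
ideals; this is `InfIrred` in the lattice of ideals. -/
def HasMinimalIrreducibleDecomposition (I : Ideal (MvPolynomial (Fin n) K)) : Prop :=
  ∃ Q : Finset (Ideal (MvPolynomial (Fin n) K)),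
    Submodule.IsMinimalPrimaryDecomposition I Q ∧ ∀ q ∈ Q, IsMonomialIdeal q ∧ InfIrred q

/-! ### The hypergraph and the graph of a monomial ideal -/

/-- The ideal `⟨x_i : i ∈ A⟩`. -/
noncomputable def variableIdeal (K : Type*) [Field K] {n : ℕ} (A : Finset (Fin n)) :
    Ideal (MvPolynomial (Fin n) K) :=
  Ideal.span (X '' (A : Set (Fin n)))

/-- The cover ideal `⋂_{A ∈ E} ⟨x_i : i ∈ A⟩` of the hypergraph on `[n]` with edge set `E`. -/
noncomputable def coverIdeal (K : Type*) [Field K] {n : ℕ} (E : Set (Finset (Fin n))) :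
    Ideal (MvPolynomial (Fin n) K) :=
  ⨅ A ∈ E, variableIdeal K A

/-- The edge set of the hypergraph `H_I` on the vertex set `[n]`: the sets `A` for which
`⟨x_i : i ∈ A⟩` is a minimal prime of `I`. By `coverIdeal_hypergraphEdges`,
`hypergraphEdges_antichain` and `eq_hypergraphEdges` below it is, for a monomial ideal `I`, the
unique hypergraph without edges contained in one another whose cover ideal is `√I`. -/
def hypergraphEdges (I : Ideal (MvPolynomial (Fin n) K)) : Set (Finset (Fin n)) :=
  {A | variableIdeal K A ∈ I.minimalPrimes}

/-- The graph `G_I` on `[n]`: its edges are the two-element edges of `H_I`. It is the hypergraph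
`H_I` itself if all edges of `H_I` have two elements. -/
def associatedGraph (I : Ideal (MvPolynomial (Fin n) K)) : SimpleGraph (Fin n) where
  Adj i j := i ≠ j ∧ ({i, j} : Finset (Fin n)) ∈ hypergraphEdges I
  symm := ⟨fun i j h => ⟨h.1.symm, by rw [Finset.pair_comm]; exact h.2⟩⟩
  loopless := ⟨fun _ h => h.1 rfl⟩

theorem variableIdeal_isPrime (A : Finset (Fin n)) : (variableIdeal K A).IsPrime := by
  classical
  let φ : MvPolynomial (Fin n) K →ₐ[K] MvPolynomial (Fin n) K :=
    aeval fun i => if i ∈ A then 0 else X i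
  have key : ∀ f, f - φ f ∈ variableIdeal K A := by
    intro f
    induction f using MvPolynomial.induction_on with
    | C a => simp [φ]
    | add p q hp hq =>
      have : p + q - φ (p + q) = (p - φ p) + (q - φ q) := by rw [map_add]; ring
      rw [this]
      exact add_mem hp hq
    | mul_X p i hp =>
      have : p * X i - φ (p * X i) = (p - φ p) * X i + φ p * (X i - φ (X i)) := by
        rw [map_mul]; ring
      rw [this]
      refine add_mem (Ideal.mul_mem_right _ _ hp) (Ideal.mul_mem_left _ _ ?_)
      by_cases hi : i ∈ A
      · have : (X i : MvPolynomial (Fin n) K) - φ (X i) = X i := by simp [φ, hi]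
        rw [this]
        exact Ideal.subset_span ⟨i, hi, rfl⟩
      · simp [φ, hi]
  have hker : variableIdeal K A = RingHom.ker φ := by
    apply le_antisymm
    · refine Ideal.span_le.2 ?_
      rintro _ ⟨i, hi, rfl⟩
      have : i ∈ A := hi
      simp [φ, this]
    · intro f hf
      have h := key f
      rwa [(RingHom.mem_ker).1 hf, sub_zero] at h
  rw [hker]
  exact RingHom.ker_isPrime _

theorem X_mem_variableIdeal {A : Finset (Fin n)} {i : Fin n} :
    (X i : MvPolynomial (Fin n) K) ∈ variableIdeal K A ↔ i ∈ A := by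
  classical
  simp only [variableIdeal, mem_ideal_span_X_image, support_X, Finset.mem_singleton, forall_eq,
    Finset.mem_coe]
  constructor
  · rintro ⟨j, hj, h⟩
    rw [Finsupp.single_apply] at h
    split_ifs at h with hij
    · exact hij ▸ hj
    · exact absurd rfl h
  · exact fun h => ⟨i, h, by simp⟩

theorem variableIdeal_le_iff {A B : Finset (Fin n)} :
    variableIdeal K A ≤ variableIdeal K B ↔ A ⊆ B := by
  constructor
  · intro h i hi
    exact X_mem_variableIdeal.1 (h (X_mem_variableIdeal.2 hi))
  · intro h
    exact Ideal.span_mono (Set.image_mono (by exact_mod_cast h))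

/-- Every minimal prime of a monomial ideal is generated by variables. -/
theorem exists_variableIdeal_eq {I : Ideal (MvPolynomial (Fin n) K)} (hI : IsMonomialIdeal I)
    {p : Ideal (MvPolynomial (Fin n) K)} (hp : p ∈ I.minimalPrimes) :
    ∃ A, variableIdeal K A = p := by
  classical
  obtain ⟨S, rfl⟩ := hI
  have hprime : p.IsPrime := hp.1.1
  let A : Finset (Fin n) := Finset.univ.filter fun i => (X i : MvPolynomial (Fin n) K) ∈ p
  have hle : variableIdeal K A ≤ p := by
    refine Ideal.span_le.2 ?_
    rintro _ ⟨i, hi, rfl⟩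
    exact (Finset.mem_filter.1 hi).2
  refine ⟨A, le_antisymm hle (hp.2 ⟨variableIdeal_isPrime A, ?_⟩ hle)⟩
  refine Ideal.span_le.2 ?_
  rintro _ ⟨a, ha, rfl⟩
  have hmem : monomial a (1 : K) ∈ p := hp.1.2 (Ideal.subset_span ⟨a, ha, rfl⟩)
  rw [monomial_eq, C_1, one_mul, Finsupp.prod, hprime.prod_mem_iff] at hmem
  obtain ⟨i, hi, hip⟩ := hmem
  have hiA : i ∈ A := Finset.mem_filter.2 ⟨Finset.mem_univ i, hprime.mem_of_pow_mem _ hip⟩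
  simp only [SetLike.mem_coe, variableIdeal, mem_ideal_span_X_image]
  intro m hm
  have : m = a := by
    have := support_monomial_subset hm
    simpa using this
  exact ⟨i, hiA, this ▸ Finsupp.mem_support_iff.1 hi⟩

/-- The cover ideal of `H_I` is `√I`. -/
theorem coverIdeal_hypergraphEdges {I : Ideal (MvPolynomial (Fin n) K)} (hI : IsMonomialIdeal I) :
    coverIdeal K (hypergraphEdges I) = I.radical := by
  rw [← Ideal.sInf_minimalPrimes]
  apply le_antisymm
  · refine le_sInf fun p hp => ?_
    obtain ⟨A, rfl⟩ := exists_variableIdeal_eq hI hp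
    exact iInf₂_le A hp
  · exact le_iInf₂ fun A hA => sInf_le hA

/-- No edge of `H_I` is contained in another one. -/
theorem hypergraphEdges_antichain (I : Ideal (MvPolynomial (Fin n) K)) :
    IsAntichain (· ⊆ ·) (hypergraphEdges I) := by
  intro A hA B hB hne hAB
  exact hne (Finset.Subset.antisymm hAB
    (variableIdeal_le_iff.1 (hB.2 hA.1 (variableIdeal_le_iff.2 hAB))))

/-- `H_I` is the only hypergraph without edges contained in one another whose cover ideal
is `√I`. -/
theorem eq_hypergraphEdges {I : Ideal (MvPolynomial (Fin n) K)} {E : Set (Finset (Fin n))}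
    (hE : IsAntichain (· ⊆ ·) E) (hcover : coverIdeal K E = I.radical) :
    E = hypergraphEdges I := by
  classical
  have hfin : E.Finite := Set.toFinite E
  have hcov : ∀ p : Ideal (MvPolynomial (Fin n) K), p.IsPrime → I ≤ p →
      ∃ A ∈ E, variableIdeal K A ≤ p := by
    intro p hp hIp
    have h1 : coverIdeal K E ≤ p := hcover ▸ (hp.radical_le_iff.2 hIp)
    have h2 : hfin.toFinset.inf (variableIdeal K) ≤ p := by
      refine le_trans (le_iInf₂ fun A hA => ?_) h1
      exact Finset.inf_le (hfin.mem_toFinset.2 hA)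
    obtain ⟨A, hA, h⟩ := (Ideal.IsPrime.inf_le' hp).1 h2
    exact ⟨A, hfin.mem_toFinset.1 hA, h⟩
  have hle : ∀ A ∈ E, I ≤ variableIdeal K A := fun A hA =>
    Ideal.le_radical.trans (hcover ▸ iInf₂_le A hA)
  ext A
  constructor
  · intro hA
    refine ⟨⟨variableIdeal_isPrime A, hle A hA⟩, ?_⟩
    rintro p ⟨hp, hIp⟩ hpA
    obtain ⟨B, hB, hBp⟩ := hcov p hp hIp
    have hBA : B = A := hE.eq hB hA (variableIdeal_le_iff.1 (hBp.trans hpA))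
    exact hBA ▸ hBp
  · intro hA
    obtain ⟨B, hB, hBA⟩ := hcov _ hA.1.1 hA.1.2
    have : variableIdeal K A ≤ variableIdeal K B :=
      hA.2 ⟨variableIdeal_isPrime B, hle B hB⟩ hBA
    have hAB : A = B :=
      Finset.Subset.antisymm (variableIdeal_le_iff.1 this) (variableIdeal_le_iff.1 hBA)
    exact hAB ▸ hB

end Monomial

end SimisIdeals

/-! Once all edges have two elements, the irreducible components of `I` are `⟨x_i ^ w i j, x_j ^ w j
i⟩`, one for each edge `ij`. A monomial `x^m` therefore lies in `I` iff `m` is a cover of the graph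
for weights that may depend on the edge (`exists_edge_weights`). Symbolic powers are equally
explicit: `x^m` lies in `I^(s)` iff `⌊m_i / w i j⌋ + ⌊m_j / w j i⌋ ≥ s` on every edge
(`isWeightedCoverOfOrder_of_mem_symbolicPower`, `monomial_mem_symbolicPower`).

So `I^(2) = I^2` makes every cover of order two dominate a sum of two covers. Testing this on
vectors that are restrictive at only three vertices forces the weights at a vertex to agree on all
its edges (`CoversSplit.not_weight_lt`), which is a standard linear weighting. The vector of vertex
weights is then itself a cover of order two, and its splitting is a 2-colouring.

Conversely, a standard linear weighting makes the weights depend on the vertex only, and a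
2-colouring distributes a cover of order `s` over `s` covers (`exists_covers_of_isBipartite`), so
`I^(s) ⊆ I^s`. -/

namespace SimisIdeals

open MvPolynomial

/-! ### Splitting weighted covers of graphs -/

section Combinatorics

variable {V : Type*}

/-- `c` is a cover of the graph `G` with respect to the edge-dependent weights `w`: on every edge
`{i, j}` one of the inequalities `w i j ≤ c i` and `w j i ≤ c j` holds. -/
def IsWeightedCover (G : SimpleGraph V) (w : V → V → ℕ) (c : V → ℕ) : Prop :=
  ∀ i j, G.Adj i j → w i j ≤ c i ∨ w j i ≤ c j

/-- `a` is a cover of order `s` of the graph `G` with respect to the edge-dependent weights `w`. -/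
def IsWeightedCoverOfOrder (G : SimpleGraph V) (w : V → V → ℕ) (s : ℕ) (a : V → ℕ) : Prop :=
  ∀ i j, G.Adj i j → s ≤ a i / w i j + a j / w j i

/-- Every cover of order two is the sum of two covers, up to a nonnegative vector. -/
def CoversSplit (G : SimpleGraph V) (w : V → V → ℕ) : Prop :=
  ∀ a, IsWeightedCoverOfOrder G w 2 a →
    ∃ c d, IsWeightedCover G w c ∧ IsWeightedCover G w d ∧ ∀ l, c l + d l ≤ a l

variable {G : SimpleGraph V} {w : V → V → ℕ}

theorem exists_weight_bound [Finite V] (w : V → V → ℕ) : ∃ B, ∀ p q, w p q ≤ B := by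
  obtain ⟨B, hB⟩ := (Set.finite_range fun x : V × V => w x.1 x.2).bddAbove
  exact ⟨B, fun p q => hB ⟨(p, q), rfl⟩⟩

/-- Splitting can be tested on three vertices: the entry `2 * B` elsewhere, with `B` bounding all
weights, satisfies every edge that leaves the triple. -/
theorem CoversSplit.exists_on_triple [Finite V] (hw : ∀ i j, G.Adj i j → 0 < w i j)
    (H : CoversSplit G w) {i j k : V} (hij : i ≠ j) (hik : i ≠ k) (hjk : j ≠ k) (x y z : ℕ)
    (h₁ : G.Adj i j → 2 ≤ x / w i j + y / w j i) (h₂ : G.Adj i k → 2 ≤ x / w i k + z / w k i)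
    (h₃ : G.Adj j k → 2 ≤ y / w j k + z / w k j) :
    ∃ c d, IsWeightedCover G w c ∧ IsWeightedCover G w d ∧ c i + d i ≤ x ∧ c j + d j ≤ y ∧
      c k + d k ≤ z := by
  classical
  obtain ⟨B, hwB⟩ := exists_weight_bound w
  set a : V → ℕ := fun l => if l = i then x else if l = j then y else if l = k then z else 2 * B
    with ha
  have hai : a i = x := by simp [ha]
  have haj : a j = y := by simp [ha, hij.symm]
  have hak : a k = z := by simp [ha, hik.symm, hjk.symm]
  have hao : ∀ p, p ≠ i → p ≠ j → p ≠ k → ∀ q, G.Adj p q → 2 ≤ a p / w p q := by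
    intro p h1 h2 h3 q hpq
    rw [Nat.le_div_iff_mul_le (hw p q hpq)]
    simp only [ha, h1, h2, h3, if_false]
    exact Nat.mul_le_mul_left 2 (hwB p q)
  have ha2 : IsWeightedCoverOfOrder G w 2 a := by
    intro p q hpq
    by_cases hp : p = i ∨ p = j ∨ p = k
    · by_cases hq : q = i ∨ q = j ∨ q = k
      · rcases hp with rfl | rfl | rfl <;> rcases hq with rfl | rfl | rfl <;>
          simp only [hai, haj, hak] <;>
          first
          | exact absurd hpq (G.loopless.irrefl _)
          | exact h₁ hpq
          | exact h₂ hpq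
          | exact h₃ hpq
          | (rw [add_comm]; first | exact h₁ hpq.symm | exact h₂ hpq.symm | exact h₃ hpq.symm)
      · push Not at hq
        exact (hao q hq.1 hq.2.1 hq.2.2 p hpq.symm).trans (Nat.le_add_left _ _)
    · push Not at hp
      exact (hao p hp.1 hp.2.1 hp.2.2 q hpq).trans (Nat.le_add_right _ _)
  obtain ⟨c, d, hc, hd, hcd⟩ := H a ha2
  exact ⟨c, d, hc, hd, hai ▸ hcd i, haj ▸ hcd j, hak ▸ hcd k⟩

/-- The test vector below cannot split. Its entry at `j` makes both covers spend `w i j` at `i`; its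
entry at `k` makes one of them spend `w i k` there; together this exceeds the entry at `i` by one.
Since the edges `ij` and `ik` meet the order two condition, `jk` must be an edge that violates it,
which is the conclusion. -/
theorem CoversSplit.adj_of_weight_lt [Finite V] (hw : ∀ i j, G.Adj i j → 0 < w i j)
    (H : CoversSplit G w) {i j k : V} (hij : G.Adj i j) (hik : G.Adj i k)
    (hlt : w i j < w i k) :
    G.Adj j k ∧ w k i ≤ w k j ∧
      (w j i ≤ w j k ∨ (2 * w k i ≤ w k j ∧ w j i ≤ 2 * w j k)) := by
  have hjk : j ≠ k := by rintro rfl; exact lt_irrefl _ hlt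
  have hp := hw _ _ hij.symm
  have hr := hw _ _ hik.symm
  have hu := hw _ _ hij
  by_contra hcon
  obtain ⟨c, d, hc, hd, h1, h2, h3⟩ := H.exists_on_triple hw hij.ne hik.ne hjk
    (w i k + w i j - 1) (w j i - 1) (2 * w k i - 1)
    (fun _ => (Nat.le_div_iff_mul_le hu).2 (by omega) |>.trans (Nat.le_add_right _ _))
    (fun _ => Nat.add_le_add (a := 1) (c := 1) ((Nat.le_div_iff_mul_le (hw _ _ hik)).2 (by omega))
      ((Nat.le_div_iff_mul_le hr).2 (by omega)))
    (fun h => by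
      have hs := hw _ _ h
      have ht := hw _ _ h.symm
      by_cases h1 : w k j < w k i
      · exact (Nat.le_div_iff_mul_le ht).2 (by omega) |>.trans (Nat.le_add_left _ _)
      by_cases h2 : 2 * w j k < w j i
      · exact (Nat.le_div_iff_mul_le hs).2 (by omega) |>.trans (Nat.le_add_right _ _)
      have h3 : ¬ w j i ≤ w j k := fun h3 => hcon ⟨h, by omega, .inl h3⟩
      have h4 : ¬ 2 * w k i ≤ w k j := fun h4 => hcon ⟨h, by omega, .inr ⟨h4, by omega⟩⟩
      exact Nat.add_le_add (a := 1) (c := 1) ((Nat.le_div_iff_mul_le hs).2 (by omega))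
        ((Nat.le_div_iff_mul_le ht).2 (by omega)))
  have := hc i j hij
  have := hc i k hik
  have := hd i j hij
  have := hd i k hik
  omega

theorem CoversSplit.not_weight_lt [Finite V] (hw : ∀ i j, G.Adj i j → 0 < w i j)
    (H : CoversSplit G w) {i j k : V} (hij : G.Adj i j) (hik : G.Adj i k) :
    ¬ w i j < w i k := by
  intro hlt
  have hne : j ≠ k := by rintro rfl; exact lt_irrefl _ hlt
  obtain ⟨hjk, hrt, hor⟩ := H.adj_of_weight_lt hw hij hik hlt
  have hu := hw _ _ hij
  have hM := hw _ _ hik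
  have hp := hw _ _ hij.symm
  have hr := hw _ _ hik.symm
  have hs := hw _ _ hjk
  have ht := hw _ _ hjk.symm
  rcases hrt.eq_or_lt with heq | hrt
  -- Here `hor` leaves only `w j i ≤ w j k`. The entry at `k` serves at most one cover; a cover not
  -- served there uses up `i` and `j`, and the other is then zero at both ends of `ij`.
  · obtain ⟨c, d, hc, hd, h1, h2, h3⟩ := H.exists_on_triple hw hij.ne hik.ne hne
      (w i k) (w j k) (w k i)
      (fun _ => Nat.add_le_add (a := 1) (c := 1) ((Nat.le_div_iff_mul_le hu).2 (by omega))
        ((Nat.le_div_iff_mul_le hp).2 (by omega)))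
      (fun _ => Nat.add_le_add (a := 1) (c := 1) ((Nat.le_div_iff_mul_le hM).2 (by omega))
        ((Nat.le_div_iff_mul_le hr).2 (by omega)))
      (fun _ => Nat.add_le_add (a := 1) (c := 1) ((Nat.le_div_iff_mul_le hs).2 (by omega))
        ((Nat.le_div_iff_mul_le ht).2 (by omega)))
    have := hc i j hij
    have := hc i k hik
    have := hc j k hjk
    have := hd i j hij
    have := hd i k hik
    have := hd j k hjk
    omega
  -- Going around the triangle, the strict inequality propagates to every vertex, and the surviving
  -- alternatives say that the larger weight is exactly twice the smaller: `w i k = 2 * w i j`, `w j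
  -- i = 2 * w j k`, `w k j = 2 * w k i`.
  · obtain ⟨-, hk1, hk2⟩ := H.adj_of_weight_lt hw hik.symm hjk.symm hrt
    obtain ⟨-, hj1, hj2⟩ := H.adj_of_weight_lt hw hjk hij.symm (by omega)
    -- The entry at `k` is too small for `jk`, so both covers equal `w j k` at `j`. That is too
    -- small for `ij`, so both equal `w i j` at `i`. That is too small for `ik`, so both need `w k
    -- i` at `k`, where only one `w k i` is available.
    obtain ⟨c, d, hc, hd, h1, h2, h3⟩ := H.exists_on_triple hw hij.ne hik.ne hne
      (2 * w i j) (2 * w j k) (w k i)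
      (fun _ => (Nat.le_div_iff_mul_le hu).2 (by omega) |>.trans (Nat.le_add_right _ _))
      (fun _ => Nat.add_le_add (a := 1) (c := 1) ((Nat.le_div_iff_mul_le hM).2 (by omega))
        ((Nat.le_div_iff_mul_le hr).2 (by omega)))
      (fun _ => (Nat.le_div_iff_mul_le hs).2 (by omega) |>.trans (Nat.le_add_right _ _))
    have := hc i j hij
    have := hc i k hik
    have := hc j k hjk
    have := hd i j hij
    have := hd i k hik
    have := hd j k hjk
    omega

/-- If all covers of order two split, then the weights depend only on the vertices. -/
theorem CoversSplit.exists_vertex_weight [Finite V] (hw : ∀ i j, G.Adj i j → 0 < w i j)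
    (H : CoversSplit G w) :
    ∃ v : V → ℕ, (∀ i, 0 < v i) ∧ ∀ i j, G.Adj i j → w i j = v i := by
  classical
  -- Isolated vertices carry no weight; the value 1 keeps `v` positive.
  refine ⟨fun i => if h : ∃ j, G.Adj i j then w i h.choose else 1, fun i => ?_, fun i j hij => ?_⟩
  · by_cases h : ∃ j, G.Adj i j
    · simpa [h] using hw _ _ h.choose_spec
    · simp [h]
  · have h : ∃ j, G.Adj i j := ⟨j, hij⟩
    simp only [h, dif_pos]
    exact le_antisymm (not_lt.1 (H.not_weight_lt hw h.choose_spec hij))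
      (not_lt.1 (H.not_weight_lt hw hij h.choose_spec))

/-- Split `v` itself: at each vertex at most one of the two covers reaches `v i`, and on each edge
both covers must reach it somewhere. Hence the first cover reaches it at exactly one end of every
edge. -/
theorem CoversSplit.isBipartite {v : V → ℕ} (hv : ∀ i, 0 < v i)
    (H : CoversSplit G fun i _ => v i) : G.IsBipartite := by
  classical
  obtain ⟨c, d, hc, hd, hcd⟩ := H v fun i j _ => by
    simp [Nat.div_self (hv i), Nat.div_self (hv j)]
  refine ⟨SimpleGraph.Coloring.mk (fun i => if v i ≤ c i then (0 : Fin 2) else 1) ?_⟩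
  intro i j hij heq
  have h1 : v i ≤ c i ∨ v j ≤ c j := hc i j hij
  have h2 : v i ≤ d i ∨ v j ≤ d j := hd i j hij
  have h3 := hcd i
  have h4 := hcd j
  have h5 := hv i
  have h6 := hv j
  by_cases hi : v i ≤ c i <;> by_cases hj : v j ≤ c j <;> simp [hi, hj] at heq <;> omega

/-- On a bipartite graph every cover of order `s` dominates a sum of `s` covers. -/
theorem exists_covers_of_isBipartite {v : V → ℕ} (hG : G.IsBipartite) {s : ℕ}
    {a : V → ℕ} (ha : IsWeightedCoverOfOrder G (fun i _ => v i) s a) :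
    ∃ c : ℕ → V → ℕ, (∀ k ∈ Finset.range s, IsWeightedCover G (fun i _ => v i) (c k)) ∧
      ∀ l, ∑ k ∈ Finset.range s, c k l ≤ a l := by
  classical
  obtain ⟨f⟩ := hG
  -- With `b l = a l / v l`, one colour class joins the first `b l` of the `s` covers and the other
  -- class the last `b l`. On an edge these ranges exhaust all indices because `b i + b j ≥ s`.
  refine ⟨fun k l => if (if f l = 0 then k else s - 1 - k) < a l / v l then v l else 0, ?_, ?_⟩
  · intro k hk i j hij
    have hks := Finset.mem_range.1 hk
    have h := ha i j hij
    have hne : f i ≠ f j := f.valid hij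
    simp only at h ⊢
    by_cases h1 : f i = 0
    · have h2 : f j ≠ 0 := fun h2 => hne (h1.trans h2.symm)
      simp only [h1, h2, if_true, if_false]
      by_cases h3 : k < a i / v i
      · simp [h3]
      · have : s - 1 - k < a j / v j := by omega
        simp [this]
    · have h2 : f j = 0 := by omega
      simp only [h1, h2, if_true, if_false]
      by_cases h3 : k < a j / v j
      · simp [h3]
      · have : s - 1 - k < a i / v i := by omega
        simp [this]
  · intro l
    have key : ∀ b : ℕ, ∑ k ∈ Finset.range s, (if k < b then v l else 0) ≤ b * v l := by
      intro b
      rw [← Finset.sum_filter, Finset.sum_const, smul_eq_mul]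
      refine Nat.mul_le_mul_right _ ?_
      calc _ ≤ (Finset.range b).card := Finset.card_le_card fun k hk => by
            simpa using (Finset.mem_filter.1 hk).2
        _ = b := Finset.card_range b
    by_cases h : f l = 0
    · simp only [h, if_true]
      exact (key _).trans (Nat.div_mul_le_self _ _)
    · simp only [h, if_false]
      rw [Finset.sum_range_reflect (fun k => if k < a l / v l then v l else 0) s]
      exact (key _).trans (Nat.div_mul_le_self _ _)

end Combinatorics

/-! ### Monomial ideals and irreducible monomial ideals -/

section MonomialIdeals

variable {K : Type*} [Field K] {n : ℕ}

theorem IsMonomialIdeal.mem_iff {I : Ideal (MvPolynomial (Fin n) K)} (hI : IsMonomialIdeal I)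
    {f : MvPolynomial (Fin n) K} : f ∈ I ↔ ∀ m ∈ f.support, monomial m (1 : K) ∈ I := by
  classical
  obtain ⟨S, rfl⟩ := hI
  simp only [mem_ideal_span_monomial_image, support_monomial, one_ne_zero, if_false,
    Finset.mem_singleton, forall_eq]

theorem monomial_mem_span_iff {S : Set (Fin n →₀ ℕ)} {m : Fin n →₀ ℕ} :
    monomial m (1 : K) ∈ Ideal.span ((fun a => monomial a (1 : K)) '' S) ↔ ∃ a ∈ S, a ≤ m := by
  classical
  simp only [mem_ideal_span_monomial_image, support_monomial, one_ne_zero, if_false,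
    Finset.mem_singleton, forall_eq]

theorem monomial_mem_of_le {I : Ideal (MvPolynomial (Fin n) K)} {a b : Fin n →₀ ℕ} (hab : a ≤ b)
    (ha : monomial a (1 : K) ∈ I) : monomial b (1 : K) ∈ I := by
  have : monomial b (1 : K) = monomial (b - a) 1 * monomial a 1 := by
    rw [monomial_mul, tsub_add_cancel_of_le hab, one_mul]
  rw [this]
  exact I.mul_mem_left _ ha

theorem IsMonomialIdeal.sup_span_monomial {I : Ideal (MvPolynomial (Fin n) K)}
    (hI : IsMonomialIdeal I) (u : Fin n →₀ ℕ) :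
    IsMonomialIdeal (I ⊔ Ideal.span {monomial u (1 : K)}) := by
  obtain ⟨S, rfl⟩ := hI
  exact ⟨S ∪ {u}, by rw [Set.image_union, Set.image_singleton, Ideal.span_union]⟩

theorem IsMonomialIdeal.monomial_mem_sup_span_iff {I : Ideal (MvPolynomial (Fin n) K)}
    (hI : IsMonomialIdeal I) {u m : Fin n →₀ ℕ} :
    monomial m (1 : K) ∈ I ⊔ Ideal.span {monomial u (1 : K)} ↔
      monomial m (1 : K) ∈ I ∨ u ≤ m := by
  obtain ⟨S, rfl⟩ := hI
  have : Ideal.span ((fun a => monomial a (1 : K)) '' S) ⊔ Ideal.span {monomial u (1 : K)} =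
      Ideal.span ((fun a => monomial a (1 : K)) '' (S ∪ {u})) := by
    rw [Set.image_union, Set.image_singleton, Ideal.span_union]
  rw [this, monomial_mem_span_iff, monomial_mem_span_iff]
  simp only [Set.union_singleton, Set.mem_insert_iff, exists_eq_or_imp, or_comm]

/-- An irreducible monomial ideal containing a product of two coprime monomials contains one
of them. -/
theorem monomial_mem_or_mem_of_infIrred {q : Ideal (MvPolynomial (Fin n) K)}
    (hq : IsMonomialIdeal q) (hirr : InfIrred q) {u v : Fin n →₀ ℕ} (huv : u + v ≤ u ⊔ v)
    (h : monomial (u + v) (1 : K) ∈ q) : monomial u (1 : K) ∈ q ∨ monomial v (1 : K) ∈ q := by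
  -- For coprime monomials the lcm is the product, which lies in `q`, so adjoining each of them and
  -- intersecting returns `q`.
  have hinf : (q ⊔ Ideal.span {monomial u (1 : K)}) ⊓ (q ⊔ Ideal.span {monomial v (1 : K)}) = q := by
    refine le_antisymm (fun f hf => hq.mem_iff.2 fun m hm => ?_) (le_inf le_sup_left le_sup_left)
    have h1 := hq.monomial_mem_sup_span_iff.1 ((hq.sup_span_monomial u).mem_iff.1 hf.1 m hm)
    have h2 := hq.monomial_mem_sup_span_iff.1 ((hq.sup_span_monomial v).mem_iff.1 hf.2 m hm)
    rcases h1 with h1 | h1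
    · exact h1
    rcases h2 with h2 | h2
    · exact h2
    exact monomial_mem_of_le (huv.trans (sup_le h1 h2)) h
  rcases hirr.2 hinf with h | h
  · exact .inl (h ▸ Ideal.mem_sup_right (Ideal.mem_span_singleton_self _))
  · exact .inr (h ▸ Ideal.mem_sup_right (Ideal.mem_span_singleton_self _))

/-- Every monomial of an irreducible monomial ideal is divisible by a pure power in the ideal. -/
theorem exists_pure_power_mem_of_infIrred {q : Ideal (MvPolynomial (Fin n) K)}
    (hq : IsMonomialIdeal q) (hirr : InfIrred q) (a : Fin n →₀ ℕ)
    (h : monomial a (1 : K) ∈ q) : ∃ i, (X i : MvPolynomial (Fin n) K) ^ a i ∈ q := by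
  induction a using Finsupp.induction with
  | zero =>
    refine absurd ((Ideal.eq_top_iff_one _).2 h) fun htop => hirr.1 ?_
    exact htop ▸ isMax_top
  | single_add i b f hi hb ih =>
    have hcop : Finsupp.single i b + f ≤ Finsupp.single i b ⊔ f := by
      intro l
      by_cases hl : l = i
      · subst hl
        simp [Finsupp.notMem_support_iff.1 hi]
      · simp [Ne.symm hl]
    rcases monomial_mem_or_mem_of_infIrred hq hirr hcop h with h | h
    · refine ⟨i, ?_⟩
      simpa [X_pow_eq_monomial, Finsupp.notMem_support_iff.1 hi] using h
    · obtain ⟨j, hj⟩ := ih h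
      refine ⟨j, Ideal.mem_of_dvd _ (pow_dvd_pow _ ?_) hj⟩
      simp

/-- An irreducible monomial ideal with radical `⟨x_i : i ∈ A⟩` is generated by pure powers of
the variables `x_i`, `i ∈ A`. -/
theorem exists_exponents_of_infIrred {q : Ideal (MvPolynomial (Fin n) K)}
    (hq : IsMonomialIdeal q) (hirr : InfIrred q) {A : Finset (Fin n)}
    (hA : q.radical = variableIdeal K A) :
    ∃ v : Fin n → ℕ, (∀ i ∈ A, 0 < v i) ∧
      ∀ m : Fin n →₀ ℕ, monomial m (1 : K) ∈ q ↔ ∃ i ∈ A, v i ≤ m i := by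
  classical
  have hex : ∀ i, ∃ v : ℕ, i ∈ A → 0 < v ∧ ∀ k, (X i : MvPolynomial (Fin n) K) ^ k ∈ q ↔ v ≤ k := by
    intro i
    by_cases hi : i ∈ A
    · have hmem : ∃ k, (X i : MvPolynomial (Fin n) K) ^ k ∈ q := by
        have : (X i : MvPolynomial (Fin n) K) ∈ q.radical := hA ▸ X_mem_variableIdeal.2 hi
        exact this
      refine ⟨Nat.find hmem, fun _ => ⟨(Nat.find_pos hmem).2 fun h => ?_, fun k => ⟨fun h =>
        Nat.find_min' hmem h, fun h => Ideal.mem_of_dvd _ (pow_dvd_pow _ h) (Nat.find_spec hmem)⟩⟩⟩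
      refine hirr.1 ?_
      rw [(Ideal.eq_top_iff_one q).2 (by simpa using h)]
      exact isMax_top
    · exact ⟨0, fun h => absurd h hi⟩
  choose v hv using hex
  refine ⟨v, fun i hi => (hv i hi).1, fun m => ⟨fun h => ?_, ?_⟩⟩
  · obtain ⟨i, hi⟩ := exists_pure_power_mem_of_infIrred hq hirr m h
    have hiA : i ∈ A := X_mem_variableIdeal.1 (hA ▸ (show X i ∈ q.radical from ⟨m i, hi⟩))
    exact ⟨i, hiA, ((hv i hiA).2 _).1 hi⟩
  · rintro ⟨i, hi, hle⟩
    have h := ((hv i hi).2 _).2 hle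
    rw [X_pow_eq_monomial] at h
    exact monomial_mem_of_le (by simp) h

end MonomialIdeals

/-! ### Associated primes and heights -/

section AssociatedPrimes

/-- Links the hypotheses, which concern the module `R ⧸ I`, with primary decompositions, whose
radicals are associated primes of the submodule `I`. -/
theorem associatedPrimes_quotient {R : Type*} [CommRing R] (I : Ideal R) :
    associatedPrimes R (R ⧸ I) = Submodule.associatedPrimes I := by
  have hcolon : ∀ x : R, (⊥ : Submodule R (R ⧸ I)).colon {Ideal.Quotient.mk I x} =
      Submodule.colon I {x} := by
    intro x
    ext r
    rw [Submodule.mem_colon_singleton, Submodule.mem_colon_singleton, Submodule.mem_bot,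
      ← Ideal.Quotient.eq_zero_iff_mem, smul_eq_mul, map_mul, Algebra.smul_def]
    rfl
  ext p
  constructor
  · rintro ⟨hp, x, hx⟩
    obtain ⟨x, rfl⟩ := Ideal.Quotient.mk_surjective x
    exact ⟨hp, x, by rw [hx, hcolon]⟩
  · rintro ⟨hp, x, hx⟩
    exact ⟨hp, Ideal.Quotient.mk I x, by rw [hx, hcolon]⟩

theorem mem_associatedPrimes_of_mem_minimalPrimes {R : Type*} [CommRing R] [IsNoetherianRing R]
    {I p : Ideal R} (hp : p ∈ I.minimalPrimes) : p ∈ associatedPrimes R (R ⧸ I) := by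
  apply Module.associatedPrimes.minimalPrimes_annihilator_subset_associatedPrimes R (R ⧸ I)
  rwa [Ideal.annihilator_quotient]

theorem associatedPrimes_eq_minimalPrimes {R : Type*} [CommRing R] [IsNoetherianRing R]
    {I : Ideal R} (hI : ∀ p, ¬ IsEmbeddedPrime I p) :
    associatedPrimes R (R ⧸ I) = I.minimalPrimes := by
  refine Set.Subset.antisymm (fun p hp => ?_) fun p hp =>
    mem_associatedPrimes_of_mem_minimalPrimes hp
  have hprime : p.IsPrime := hp.1
  have hle : I ≤ p := by
    have := IsAssociatedPrime.annihilator_le hp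
    rwa [Submodule.annihilator_top, Ideal.annihilator_quotient] at this
  obtain ⟨p', hp', hle'⟩ := Ideal.exists_minimalPrimes_le hle
  rcases hle'.eq_or_lt with rfl | hlt
  · exact hp'
  · exact absurd ⟨hp, p', mem_associatedPrimes_of_mem_minimalPrimes hp', hlt⟩ (hI p)

theorem IsMinimalPrimaryDecomposition.radical_mem_associatedPrimes {R : Type*} [CommRing R]
    {I : Ideal R} {Q : Finset (Ideal R)} (hQ : Submodule.IsMinimalPrimaryDecomposition I Q)
    {q : Ideal R} (hq : q ∈ Q) : q.radical ∈ associatedPrimes R (R ⧸ I) := by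
  rw [associatedPrimes_quotient]
  have := hQ.mem_associatedPrimes hq
  rwa [Submodule.colon_univ] at this

variable {K : Type*} [Field K] {n : ℕ}

/-- Adjoining the variables one at a time gives a strict chain of primes; the opposite bound is
Krull's height theorem. -/
theorem card_le_height_variableIdeal (A : Finset (Fin n)) :
    (A.card : ℕ∞) ≤ (variableIdeal K A).height := by
  classical
  induction A using Finset.induction_on with
  | empty => simp
  | insert i A hi ih =>
    have := variableIdeal_isPrime (K := K) A
    have := variableIdeal_isPrime (K := K) (insert i A)
    have hlt : variableIdeal K A < variableIdeal K (insert i A) :=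
      lt_of_le_of_ne (variableIdeal_le_iff.2 (Finset.subset_insert _ _)) fun h =>
        hi (variableIdeal_le_iff.1 h.ge (Finset.mem_insert_self _ _))
    rw [Finset.card_insert_of_notMem hi]
    push_cast
    exact (add_le_add_left ih 1).trans (Ideal.height_add_one_le_of_lt_of_isPrime hlt)

theorem height_variableIdeal (A : Finset (Fin n)) :
    (variableIdeal K A).height = A.card := by
  classical
  refine le_antisymm ?_ (card_le_height_variableIdeal A)
  have hprime := variableIdeal_isPrime (K := K) A
  have hspan : variableIdeal K A = Ideal.span (A.image X : Finset (MvPolynomial (Fin n) K)) := by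
    rw [variableIdeal, Finset.coe_image]
  refine (Ideal.height_le_card_of_mem_minimalPrimes_span_finset
    (s := A.image (X : Fin n → MvPolynomial (Fin n) K)) ?_).trans
    (by exact_mod_cast Finset.card_image_le)
  rw [← hspan, Ideal.minimalPrimes_eq_subsingleton_self]
  rfl

end AssociatedPrimes

/-! ### From the irreducible decomposition to edge weights -/

section EdgeWeights

variable {K : Type*} [Field K] {n : ℕ}

theorem card_eq_of_mem_hypergraphEdges {I : Ideal (MvPolynomial (Fin n) K)} {h : ℕ}
    (hheight : ∀ p ∈ associatedPrimes (MvPolynomial (Fin n) K) (MvPolynomial (Fin n) K ⧸ I),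
      p.height = h) {A : Finset (Fin n)} (hA : A ∈ hypergraphEdges I) : A.card = h := by
  have := hheight _ (mem_associatedPrimes_of_mem_minimalPrimes hA)
  rw [height_variableIdeal] at this
  exact_mod_cast this

/-- The irreducible decomposition of `I` attaches to every edge `A` of `H_I` exponents `v A i`,
`i ∈ A`. -/
theorem exists_edge_exponents {I : Ideal (MvPolynomial (Fin n) K)} (hmon : IsMonomialIdeal I)
    (hembedded : ∀ p, ¬ IsEmbeddedPrime I p) (hirr : HasMinimalIrreducibleDecomposition I) :
    ∃ v : Finset (Fin n) → Fin n → ℕ, (∀ A ∈ hypergraphEdges I, ∀ i ∈ A, 0 < v A i) ∧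
      ∀ m : Fin n →₀ ℕ, monomial m (1 : K) ∈ I ↔
        ∀ A ∈ hypergraphEdges I, ∃ i ∈ A, v A i ≤ m i := by
  classical
  obtain ⟨Q, hQ, hQirr⟩ := hirr
  -- Components with equal radical coincide, so the exponents can be indexed by `A`; the value is 0
  -- where no component has radical `⟨x_i : i ∈ A⟩`.
  have hex : ∀ A, ∃ v : Fin n → ℕ, ∀ q ∈ Q, q.radical = variableIdeal K A →
      (∀ i ∈ A, 0 < v i) ∧ ∀ m : Fin n →₀ ℕ, monomial m (1 : K) ∈ q ↔ ∃ i ∈ A, v i ≤ m i := by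
    intro A
    by_cases h : ∃ q ∈ Q, q.radical = variableIdeal K A
    · obtain ⟨q, hq, hqA⟩ := h
      obtain ⟨v, hv⟩ := exists_exponents_of_infIrred (hQirr q hq).1 (hQirr q hq).2 hqA
      refine ⟨v, fun q' hq' hq'A => ?_⟩
      have hinj := hQ.injOn _ _ hq' hq (by
        simp only [Submodule.colon_univ]
        rw [hqA, hq'A])
      exact hinj ▸ hv
    · exact ⟨0, fun q hq hqA => absurd ⟨q, hq, hqA⟩ h⟩
  choose v hv using hex
  have hmemQ : ∀ A ∈ hypergraphEdges I, ∃ q ∈ Q, q.radical = variableIdeal K A := by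
    intro A hA
    obtain ⟨q, hq, h⟩ := Ideal.IsMinimalPrimaryDecomposition.minimalPrimes_subset_image_radical hQ hA
    exact ⟨q, hq, h⟩
  -- Without embedded primes every component sits over a minimal prime, hence over an edge.
  have hmemE : ∀ q ∈ Q, ∃ A ∈ hypergraphEdges I, q.radical = variableIdeal K A := by
    intro q hq
    have h := IsMinimalPrimaryDecomposition.radical_mem_associatedPrimes hQ hq
    rw [associatedPrimes_eq_minimalPrimes hembedded] at h
    obtain ⟨A, hA⟩ := exists_variableIdeal_eq hmon h
    exact ⟨A, show variableIdeal K A ∈ I.minimalPrimes from hA.symm ▸ h, hA.symm⟩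
  have hI : ∀ f, f ∈ I ↔ ∀ q ∈ Q, f ∈ q := by
    intro f
    rw [← hQ.inf_eq]
    simp [Submodule.mem_finsetInf]
  refine ⟨v, fun A hA i hi => ?_, fun m => ?_⟩
  · obtain ⟨q, hq, hqA⟩ := hmemQ A hA
    exact (hv A q hq hqA).1 i hi
  · rw [hI]
    constructor
    · intro h A hA
      obtain ⟨q, hq, hqA⟩ := hmemQ A hA
      exact ((hv A q hq hqA).2 m).1 (h q hq)
    · intro h q hq
      obtain ⟨A, hA, hqA⟩ := hmemE q hq
      exact ((hv A q hq hqA).2 m).2 (h A hA)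

/-- If all edges of `H_I` have two elements, then the irreducible decomposition of `I` amounts to
edge-dependent weights on the graph `G_I`, and `I` consists of the covers. -/
theorem exists_edge_weights {I : Ideal (MvPolynomial (Fin n) K)} (hmon : IsMonomialIdeal I)
    (hembedded : ∀ p, ¬ IsEmbeddedPrime I p) (hirr : HasMinimalIrreducibleDecomposition I)
    (hcard : ∀ A ∈ hypergraphEdges I, A.card = 2) :
    ∃ w : Fin n → Fin n → ℕ, (∀ i j, (associatedGraph I).Adj i j → 0 < w i j) ∧
      ∀ m : Fin n →₀ ℕ, monomial m (1 : K) ∈ I ↔ IsWeightedCover (associatedGraph I) w m := by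
  classical
  obtain ⟨v, hv, hI⟩ := exists_edge_exponents hmon hembedded hirr
  refine ⟨fun i j => v {i, j} i, fun i j hij => hv _ hij.2 i (by simp), fun m => ?_⟩
  rw [hI]
  constructor
  · intro h i j hij
    simpa [Finset.pair_comm j i] using h _ hij.2
  · intro h A hA
    obtain ⟨i, j, hne, rfl⟩ := Finset.card_eq_two.1 (hcard A hA)
    simpa [Finset.pair_comm j i] using h i j ⟨hne, hA⟩

theorem mem_associatedPrimes_iff_of_card_eq_two {I : Ideal (MvPolynomial (Fin n) K)}
    (hmon : IsMonomialIdeal I) (hembedded : ∀ p, ¬ IsEmbeddedPrime I p)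
    (hcard : ∀ A ∈ hypergraphEdges I, A.card = 2) {p : Ideal (MvPolynomial (Fin n) K)} :
    p ∈ associatedPrimes (MvPolynomial (Fin n) K) (MvPolynomial (Fin n) K ⧸ I) ↔
      ∃ i j, (associatedGraph I).Adj i j ∧ p = variableIdeal K {i, j} := by
  classical
  rw [associatedPrimes_eq_minimalPrimes hembedded]
  constructor
  · intro hp
    obtain ⟨A, rfl⟩ := exists_variableIdeal_eq hmon hp
    obtain ⟨i, j, hne, rfl⟩ := Finset.card_eq_two.1 (hcard A hp)
    exact ⟨i, j, ⟨hne, hp⟩, rfl⟩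
  · rintro ⟨i, j, hij, rfl⟩
    exact hij.2

end EdgeWeights

/-! ### Symbolic powers and localization at an edge -/

section SymbolicPowers

variable {R : Type*} [CommRing R]

theorem mem_symbolicPower_iff {I : Ideal R} {s : ℕ} {f : R} :
    f ∈ symbolicPower I s ↔ ∀ p ∈ associatedPrimes R (R ⧸ I), ∃ g ∉ p, g * f ∈ I ^ s := by
  simp only [symbolicPower, Submodule.mem_iInf, Subtype.forall, Ideal.mem_comap]
  refine forall₂_congr fun p hp => ?_
  have hprime : p.IsPrime := hp.1
  rw [IsLocalization.algebraMap_mem_map_algebraMap_iff p.primeCompl]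
  rfl

theorem pow_le_symbolicPower (I : Ideal R) (s : ℕ) : I ^ s ≤ symbolicPower I s :=
  le_iInf fun _ => Ideal.le_comap_map

variable {K : Type*} [Field K] {n : ℕ}

/-- The ideal of all polynomials whose monomials `x^m` satisfy `t ≤ m_i / a + m_j / b`. -/
noncomputable def edgeOrderIdeal (K : Type*) [Field K] {n : ℕ} (i j : Fin n) (a b t : ℕ) :
    Ideal (MvPolynomial (Fin n) K) :=
  restrictSupportIdeal K {m : Fin n →₀ ℕ | t ≤ m i / a + m j / b} fun _ _ hle h =>
    le_trans h (Nat.add_le_add (Nat.div_le_div_right (hle i)) (Nat.div_le_div_right (hle j)))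

theorem mem_edgeOrderIdeal {i j : Fin n} {a b t : ℕ} {f : MvPolynomial (Fin n) K} :
    f ∈ edgeOrderIdeal K i j a b t ↔ ∀ m ∈ f.support, t ≤ m i / a + m j / b :=
  Iff.rfl

theorem edgeOrderIdeal_mul_le (i j : Fin n) (a b s t : ℕ) :
    edgeOrderIdeal K i j a b s * edgeOrderIdeal K i j a b t ≤ edgeOrderIdeal K i j a b (s + t) := by
  classical
  refine Ideal.mul_le.2 fun f hf g hg m hm => ?_
  obtain ⟨u, hu, v, hv, rfl⟩ := Finset.mem_add.1 (support_mul f g hm)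
  have h1 := mem_edgeOrderIdeal.1 hf u hu
  have h2 := mem_edgeOrderIdeal.1 hg v hv
  have h3 := Nat.div_add_div_le_add_div (x := u i) (y := v i) (z := a)
  have h4 := Nat.div_add_div_le_add_div (x := u j) (y := v j) (z := b)
  simp only [Set.mem_ofPred_eq, Finsupp.coe_add, Pi.add_apply]
  omega

theorem pow_le_edgeOrderIdeal {I : Ideal (MvPolynomial (Fin n) K)} {i j : Fin n} {a b : ℕ}
    (h : I ≤ edgeOrderIdeal K i j a b 1) (s : ℕ) : I ^ s ≤ edgeOrderIdeal K i j a b s := by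
  induction s with
  | zero => exact fun f _ m _ => Nat.zero_le _
  | succ s ih =>
    rw [pow_succ]
    exact (Ideal.mul_mono ih h).trans (edgeOrderIdeal_mul_le i j a b s 1)

theorem exists_eq_add_of_support (P : (Fin n →₀ ℕ) → Prop) (f : MvPolynomial (Fin n) K) :
    ∃ g h, f = g + h ∧ (∀ m ∈ g.support, P m) ∧ ∀ m ∈ h.support, ¬ P m := by
  classical
  have hcoeff : ∀ (P : (Fin n →₀ ℕ) → Prop) [DecidablePred P] m,
      coeff m (∑ u ∈ f.support.filter P, monomial u (coeff u f)) = if P m then coeff m f else 0 := by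
    intro P _ m
    simp only [coeff_sum, coeff_monomial, Finset.sum_ite_eq', Finset.mem_filter, mem_support_iff]
    by_cases h1 : P m <;> by_cases h2 : coeff m f = 0 <;> simp [h1, h2]
  refine ⟨∑ u ∈ f.support.filter P, monomial u (coeff u f),
    ∑ u ∈ f.support.filter fun u => ¬ P u, monomial u (coeff u f), ?_, ?_, ?_⟩
  · ext m
    rw [coeff_add, hcoeff, hcoeff]
    by_cases h : P m <;> simp [h]
  · intro m hm
    rw [mem_support_iff, hcoeff] at hm
    by_contra h
    simp [h] at hm
  · intro m hm h
    rw [mem_support_iff, hcoeff] at hm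
    simp [h] at hm

/-- Multiplying by a polynomial free of `x_i` and `x_j` preserves the exponents at `i` and `j`. If
`f₂` collects the bad monomials of `f`, then `g * f₂` lies in the ideal while all its monomials are
bad, so it vanishes. -/
theorem mem_edgeOrderIdeal_of_mul_mem_of_support {i j : Fin n} {a b t : ℕ}
    {f g : MvPolynomial (Fin n) K} (hg : ∀ m ∈ g.support, m i = 0 ∧ m j = 0) (hg0 : g ≠ 0)
    (h : g * f ∈ edgeOrderIdeal K i j a b t) : f ∈ edgeOrderIdeal K i j a b t := by
  classical
  obtain ⟨f₁, f₂, rfl, hf₁, hf₂⟩ :=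
    exists_eq_add_of_support (fun m => t ≤ m i / a + m j / b) f
  have hf₁' : f₁ ∈ edgeOrderIdeal K i j a b t := hf₁
  have hmul : g * f₂ ∈ edgeOrderIdeal K i j a b t := by
    have : g * f₂ = g * (f₁ + f₂) - g * f₁ := by ring
    rw [this]
    exact sub_mem h (Ideal.mul_mem_left _ _ hf₁')
  have hzero : g * f₂ = 0 := by
    rw [← support_eq_empty, Finset.eq_empty_iff_forall_notMem]
    intro m hm
    have h1 := mem_edgeOrderIdeal.1 hmul m hm
    obtain ⟨u, hu, v, hv, rfl⟩ := Finset.mem_add.1 (support_mul g f₂ hm)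
    refine hf₂ v hv ?_
    simpa [hg u hu] using h1
  rw [(mul_eq_zero.1 hzero).resolve_left hg0, add_zero]
  exact hf₁'

/-- Elements outside `⟨x_i, x_j⟩` are nonzerodivisors modulo this ideal, so contracting it from the
localization at that prime adds nothing. -/
theorem mem_edgeOrderIdeal_of_mul_mem {i j : Fin n} {a b t : ℕ} (ha : 0 < a) (hb : 0 < b)
    {f g : MvPolynomial (Fin n) K} (hg : g ∉ variableIdeal K {i, j})
    (h : g * f ∈ edgeOrderIdeal K i j a b t) : f ∈ edgeOrderIdeal K i j a b t := by
  classical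
  obtain ⟨g₀, g₁, rfl, hg₀, hg₁⟩ := exists_eq_add_of_support (fun m => m i = 0 ∧ m j = 0) g
  have hg₁p : g₁ ∈ variableIdeal K {i, j} := by
    rw [variableIdeal, mem_ideal_span_X_image]
    intro m hm
    have := hg₁ m hm
    by_cases hi : m i = 0
    · exact ⟨j, by simp, fun hj => this ⟨hi, hj⟩⟩
    · exact ⟨i, by simp, hi⟩
  have hg₀0 : g₀ ≠ 0 := by
    rintro rfl
    exact hg (by simpa using hg₁p)
  have hpow : ∀ k, ∀ m ∈ (g₁ ^ k).support, k ≤ m i + m j := by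
    intro k
    induction k with
    | zero => simp
    | succ k ih =>
      intro m hm
      rw [pow_succ] at hm
      obtain ⟨u, hu, v, hv, rfl⟩ := Finset.mem_add.1 (support_mul _ _ hm)
      have h1 := ih u hu
      have h2 := hg₁ v hv
      simp only [Finsupp.coe_add, Pi.add_apply]
      omega
  have hpow₀ : ∀ k, ∀ m ∈ (g₀ ^ k).support, m i = 0 ∧ m j = 0 := by
    intro k
    induction k with
    | zero =>
      intro m hm
      rw [pow_zero, support_one, Finset.mem_singleton] at hm
      simp [hm]
    | succ k ih =>
      intro m hm
      rw [pow_succ] at hm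
      obtain ⟨u, hu, v, hv, rfl⟩ := Finset.mem_add.1 (support_mul _ _ hm)
      have h1 := ih u hu
      have h2 := hg₀ v hv
      simp only [Finsupp.coe_add, Pi.add_apply]
      omega
  -- If `m i + m j ≥ t * a + t * b`, then `m i ≥ t * a` or `m j ≥ t * b`, and either suffices.
  obtain ⟨N, hN⟩ : ∃ N, N = t * a + t * b := ⟨_, rfl⟩
  have hg₁N : g₁ ^ N ∈ edgeOrderIdeal K i j a b t := by
    intro m hm
    have h1 := hpow N m hm
    rcases le_total (t * a) (m i) with h2 | h2
    · exact ((Nat.le_div_iff_mul_le ha).2 h2).trans (Nat.le_add_right _ _)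
    · exact ((Nat.le_div_iff_mul_le hb).2 (by omega)).trans (Nat.le_add_left _ _)
  refine mem_edgeOrderIdeal_of_mul_mem_of_support (hpow₀ N) (pow_ne_zero N hg₀0) ?_
  -- Modulo `g₀ + g₁` one has `g₀ ^ N = (-g₁) ^ N`, so `g₀ ^ N` may replace `g`.
  obtain ⟨c, hc⟩ := sub_dvd_pow_sub_pow g₀ (-g₁) N
  have : g₀ ^ N * f = c * ((g₀ + g₁) * f) + (-1) ^ N * f * g₁ ^ N := by
    rw [sub_neg_eq_add, neg_pow, sub_eq_iff_eq_add] at hc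
    rw [hc]
    ring
  rw [this]
  exact add_mem (Ideal.mul_mem_left _ _ h) (Ideal.mul_mem_left _ _ hg₁N)

end SymbolicPowers

/-! ### Ordinary powers, linear weightings and the Simis property -/

section Powers

variable {K : Type*} [Field K] {n : ℕ}

theorem exists_add_le_of_monomial_mem_sq {I : Ideal (MvPolynomial (Fin n) K)}
    (hmon : IsMonomialIdeal I) {a : Fin n →₀ ℕ} (ha : monomial a (1 : K) ∈ I ^ 2) :
    ∃ c d, monomial c (1 : K) ∈ I ∧ monomial d (1 : K) ∈ I ∧ c + d ≤ a := by
  obtain ⟨S, rfl⟩ := hmon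
  have hle : Ideal.span ((fun a => monomial a (1 : K)) '' S) ^ 2 ≤
      Ideal.span ((fun a => monomial a (1 : K)) '' {x | ∃ c ∈ S, ∃ d ∈ S, c + d = x}) := by
    rw [pow_two, Ideal.span_mul_span']
    refine Ideal.span_mono ?_
    rintro _ ⟨_, ⟨c, hc, rfl⟩, _, ⟨d, hd, rfl⟩, rfl⟩
    exact ⟨c + d, ⟨c, hc, d, hd, rfl⟩, by simp [monomial_mul]⟩
  obtain ⟨_, ⟨c, hc, d, hd, rfl⟩, hcd⟩ := monomial_mem_span_iff.1 (hle ha)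
  exact ⟨c, d, Ideal.subset_span ⟨c, hc, rfl⟩, Ideal.subset_span ⟨d, hd, rfl⟩, hcd⟩

theorem monomial_nsmul_mem_pow {I : Ideal (MvPolynomial (Fin n) K)} {a : Fin n →₀ ℕ}
    (ha : monomial a (1 : K) ∈ I) (k : ℕ) : monomial (k • a) (1 : K) ∈ I ^ k := by
  have := Ideal.pow_mem_pow ha k
  rwa [monomial_pow, one_pow] at this

theorem mem_of_forall_monomial_mem {I : Ideal (MvPolynomial (Fin n) K)}
    {f : MvPolynomial (Fin n) K} (h : ∀ m ∈ f.support, monomial m (1 : K) ∈ I) : f ∈ I := by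
  rw [f.as_sum]
  refine sum_mem fun m hm => ?_
  have : monomial m (coeff m f) = C (coeff m f) * monomial m 1 := by
    rw [C_mul_monomial, mul_one]
  rw [this]
  exact I.mul_mem_left _ (h m hm)

/-- The vector with the entries `x` and `y` at `i` and `j`, and `B` elsewhere. -/
noncomputable def edgeVector (i j : Fin n) (x y B : ℕ) : Fin n →₀ ℕ :=
  Finsupp.equivFunOnFinite.symm fun l => if l = i then x else if l = j then y else B

theorem edgeVector_apply (i j : Fin n) (x y B : ℕ) (l : Fin n) :
    edgeVector i j x y B l = if l = i then x else if l = j then y else B := rfl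

theorem isWeightedCover_edgeVector {G : SimpleGraph (Fin n)} {w : Fin n → Fin n → ℕ} {B : ℕ}
    (hB : ∀ p q, w p q ≤ B) {i j : Fin n} {x y : ℕ}
    (hxy : w i j ≤ x ∨ w j i ≤ y) : IsWeightedCover G w (edgeVector i j x y B) := by
  intro p q hpq
  have hne := hpq.ne
  have h1 := hB p q
  have h2 := hB q p
  simp only [edgeVector_apply]
  by_cases hpi : p = i <;> by_cases hqi : q = i <;> by_cases hpj : p = j <;>
    by_cases hqj : q = j <;> simp_all
  exact hxy.symm

variable {I : Ideal (MvPolynomial (Fin n) K)} {w : Fin n → Fin n → ℕ}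

/-- At each edge `I` lies in the edge ideal of order 1, so `I ^ s` lies in that of order `s`, which
absorbs the denominators of the localization. -/
theorem isWeightedCoverOfOrder_of_mem_symbolicPower
    (hmon : IsMonomialIdeal I) (hembedded : ∀ p, ¬ IsEmbeddedPrime I p)
    (hcard : ∀ A ∈ hypergraphEdges I, A.card = 2)
    (hw : ∀ i j, (associatedGraph I).Adj i j → 0 < w i j)
    (hI : ∀ m : Fin n →₀ ℕ, monomial m (1 : K) ∈ I ↔ IsWeightedCover (associatedGraph I) w m)
    {s : ℕ} {f : MvPolynomial (Fin n) K} (hf : f ∈ symbolicPower I s) {m : Fin n →₀ ℕ}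
    (hm : m ∈ f.support) : IsWeightedCoverOfOrder (associatedGraph I) w s m := by
  intro i j hij
  obtain ⟨g, hg, hgf⟩ := mem_symbolicPower_iff.1 hf _
    ((mem_associatedPrimes_iff_of_card_eq_two hmon hembedded hcard).2 ⟨i, j, hij, rfl⟩)
  have hle : I ≤ edgeOrderIdeal K i j (w i j) (w j i) 1 := by
    intro f hf m hm
    rcases (hI m).1 (hmon.mem_iff.1 hf m hm) i j hij with h | h
    · exact (Nat.div_pos h (hw i j hij)).trans_le (Nat.le_add_right _ _)
    · exact (Nat.div_pos h (hw j i hij.symm)).trans_le (Nat.le_add_left _ _)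
  exact mem_edgeOrderIdeal.1 (mem_edgeOrderIdeal_of_mul_mem (hw i j hij) (hw j i hij.symm) hg
    (pow_le_edgeOrderIdeal hle s hgf)) m hm

theorem monomial_mem_symbolicPower
    (hmon : IsMonomialIdeal I) (hembedded : ∀ p, ¬ IsEmbeddedPrime I p)
    (hcard : ∀ A ∈ hypergraphEdges I, A.card = 2)
    (hI : ∀ m : Fin n →₀ ℕ, monomial m (1 : K) ∈ I ↔ IsWeightedCover (associatedGraph I) w m)
    {s : ℕ} {m : Fin n →₀ ℕ} (hm : IsWeightedCoverOfOrder (associatedGraph I) w s m) :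
    monomial m (1 : K) ∈ symbolicPower I s := by
  classical
  rw [mem_symbolicPower_iff]
  intro p hp
  obtain ⟨i, j, hij, rfl⟩ :=
    (mem_associatedPrimes_iff_of_card_eq_two hmon hembedded hcard).1 hp
  obtain ⟨B, hB⟩ := exists_weight_bound w
  -- This multiplier is a unit at the edge prime and pays for `s` generators away from `i` and `j`.
  -- Of these, `k` cover the edge at `i` and `s - k` at `j`.
  refine ⟨monomial (edgeVector i j 0 0 (s * B)) 1, ?_, ?_⟩
  · intro h
    rw [variableIdeal, mem_ideal_span_X_image] at h
    obtain ⟨l, hl, hl0⟩ := h (edgeVector i j 0 0 (s * B)) (by simp [support_monomial])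
    simp only [Finset.coe_insert, Finset.coe_singleton, Set.mem_insert_iff,
      Set.mem_singleton_iff] at hl
    rcases hl with rfl | rfl <;> simp [edgeVector_apply] at hl0
  · have h₁ : monomial (edgeVector i j (w i j) 0 B) (1 : K) ∈ I :=
      (hI _).2 (isWeightedCover_edgeVector hB (.inl le_rfl))
    have h₂ : monomial (edgeVector i j 0 (w j i) B) (1 : K) ∈ I :=
      (hI _).2 (isWeightedCover_edgeVector hB (.inr le_rfl))
    have hs := hm i j hij
    obtain ⟨k, hk⟩ : ∃ k, k = min s (m i / w i j) := ⟨_, rfl⟩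
    have hks : k + (s - k) = s := by omega
    have hmul := Ideal.mul_mem_mul (monomial_nsmul_mem_pow h₁ k) (monomial_nsmul_mem_pow h₂ (s - k))
    rw [monomial_mul, one_mul, ← pow_add, hks] at hmul
    rw [monomial_mul, one_mul]
    refine monomial_mem_of_le (fun l => ?_) hmul
    simp only [Finsupp.coe_add, Finsupp.coe_smul, Pi.add_apply, Pi.smul_apply, smul_eq_mul,
      edgeVector_apply]
    have hki : k * w i j ≤ m i := (Nat.mul_le_mul_right _ (by omega)).trans (Nat.div_mul_le_self _ _)
    have hsk : ∀ x y : ℕ, s ≤ x + y → s - min s x ≤ y := fun x y _ => by omega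
    have hkj : (s - k) * w j i ≤ m j :=
      (Nat.mul_le_mul_right _ (hk ▸ hsk _ _ hs)).trans (Nat.div_mul_le_self _ _)
    by_cases hli : l = i
    · subst hli
      simpa using hki
    · by_cases hlj : l = j
      · subst hlj
        simpa [hli] using hkj
      · simp only [hli, hlj, if_false]
        rw [← add_mul, hks]
        exact Nat.le_add_right _ _

theorem coversSplit_of_symbolicPower_two_eq
    (hmon : IsMonomialIdeal I) (hembedded : ∀ p, ¬ IsEmbeddedPrime I p)
    (hcard : ∀ A ∈ hypergraphEdges I, A.card = 2)
    (hI : ∀ m : Fin n →₀ ℕ, monomial m (1 : K) ∈ I ↔ IsWeightedCover (associatedGraph I) w m)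
    (h : symbolicPower I 2 = I ^ 2) : CoversSplit (associatedGraph I) w := by
  intro a ha
  have hmem := monomial_mem_symbolicPower (m := Finsupp.equivFunOnFinite.symm a)
    hmon hembedded hcard hI ha
  obtain ⟨c, d, hc, hd, hcd⟩ := exists_add_le_of_monomial_mem_sq hmon (h ▸ hmem)
  exact ⟨c, d, (hI c).1 hc, (hI d).1 hd, fun l => hcd l⟩

theorem monomial_mem_weightedIdeal_iff {J : Ideal (MvPolynomial (Fin n) K)} {v : Fin n → ℕ}
    {m : Fin n →₀ ℕ} : monomial m (1 : K) ∈ weightedIdeal v J ↔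
      ∃ a, monomial a (1 : K) ∈ J ∧ ∀ l, v l * a l ≤ m l := by
  have : weightedIdeal v J = Ideal.span ((fun a => monomial a (1 : K)) ''
      (weightExponent v '' {a | monomial a (1 : K) ∈ J})) := by
    rw [weightedIdeal, Set.image_image]
  rw [this, monomial_mem_span_iff, Set.exists_mem_image]
  rfl

theorem hasStandardLinearWeighting_of_vertex_weights (hmon : IsMonomialIdeal I)
    {v : Fin n → ℕ} (hv : ∀ i, 0 < v i) {G : SimpleGraph (Fin n)}
    (hI : ∀ m : Fin n →₀ ℕ, monomial m (1 : K) ∈ I ↔ IsWeightedCover G (fun i _ => v i) m) :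
    HasStandardLinearWeighting I := by
  classical
  -- The candidate for `J` is the ideal of ordinary vertex covers; rounding `m` to the indicator of
  -- `v l ≤ m l` turns a weighted cover into one of these.
  let S : Set (Fin n →₀ ℕ) := {c | (∀ i, c i ≤ 1) ∧ IsWeightedCover G (fun _ _ => 1) c}
  refine ⟨Ideal.span ((fun a => monomial a (1 : K)) '' S), v, ⟨S, fun a ha => ha.1, rfl⟩, hv, ?_⟩
  apply le_antisymm
  · intro f hf
    refine mem_of_forall_monomial_mem fun m hm => ?_
    have hcov := (hI m).1 (hmon.mem_iff.1 hf m hm)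
    rw [monomial_mem_weightedIdeal_iff]
    refine ⟨Finsupp.equivFunOnFinite.symm fun l => if v l ≤ m l then 1 else 0,
      Ideal.subset_span ⟨_, ⟨fun l => ?_, fun i j hij => ?_⟩, rfl⟩, fun l => ?_⟩
    · simp only [Finsupp.equivFunOnFinite_symm_apply_apply]
      split_ifs <;> simp
    · simp only [Finsupp.equivFunOnFinite_symm_apply_apply]
      exact (hcov i j hij).imp (fun h => by simp [h]) fun h => by simp [h]
    · simp only [Finsupp.equivFunOnFinite_symm_apply_apply]
      split_ifs with h <;> simp [h]
  · rw [weightedIdeal, Ideal.span_le]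
    rintro _ ⟨b, hb, rfl⟩
    have hb' : monomial b (1 : K) ∈ Ideal.span ((fun a => monomial a (1 : K)) '' S) := hb
    obtain ⟨c, hc, hcb⟩ := monomial_mem_span_iff.1 hb'
    refine (hI _).2 fun i j hij => ?_
    simp only [weightExponent, Finsupp.equivFunOnFinite_symm_apply_apply]
    exact (hc.2 i j hij).imp (fun h => Nat.le_mul_of_pos_right _ (h.trans (hcb i)))
      fun h => Nat.le_mul_of_pos_right _ (h.trans (hcb j))

/-- Membership of a monomial `x^a` in `J_w`, with `J` squarefree, depends only on the set of
all `l` with `w_l ≤ a_l`. -/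
theorem monomial_mem_weightedIdeal_of_forall_imp {J : Ideal (MvPolynomial (Fin n) K)}
    (hJ : IsSquarefreeMonomialIdeal J) {v : Fin n → ℕ} {a b : Fin n →₀ ℕ}
    (ha : monomial a (1 : K) ∈ weightedIdeal v J) (hab : ∀ l, v l ≤ a l → v l ≤ b l) :
    monomial b (1 : K) ∈ weightedIdeal v J := by
  obtain ⟨S, hS, rfl⟩ := hJ
  rw [monomial_mem_weightedIdeal_iff] at ha ⊢
  obtain ⟨c, hc, hca⟩ := ha
  obtain ⟨d, hd, hdc⟩ := monomial_mem_span_iff.1 hc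
  refine ⟨d, Ideal.subset_span ⟨d, hd, rfl⟩, fun l => ?_⟩
  have h1 := hca l
  have h2 : d l ≤ 1 := hS d hd l
  have h3 : d l ≤ c l := hdc l
  rcases Nat.le_one_iff_eq_zero_or_eq_one.1 h2 with h | h
  · simp [h]
  · rw [h, mul_one]
    exact hab l ((Nat.le_mul_of_pos_right _ (by omega)).trans h1)

/-- With 0 at `j` and large entries elsewhere, membership in `I` switches on exactly when the entry
at `i` reaches `w i j`. Membership in `J_w` can change only at `v i`, so the two thresholds agree.
-/
theorem exists_vertex_weights_of_hasStandardLinearWeighting {G : SimpleGraph (Fin n)}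
    (hw : ∀ i j, G.Adj i j → 0 < w i j)
    (hI : ∀ m : Fin n →₀ ℕ, monomial m (1 : K) ∈ I ↔ IsWeightedCover G w m)
    (h : HasStandardLinearWeighting I) :
    ∃ v : Fin n → ℕ, ∀ i j, G.Adj i j → w i j = v i := by
  obtain ⟨J, v, hJ, -, hIJ⟩ := h
  have key : ∀ a b : Fin n →₀ ℕ, monomial a (1 : K) ∈ I → (∀ l, v l ≤ a l → v l ≤ b l) →
      monomial b (1 : K) ∈ I := by
    rw [hIJ]
    exact fun a b => monomial_mem_weightedIdeal_of_forall_imp hJ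
  refine ⟨v, fun i j hij => ?_⟩
  obtain ⟨B, hB⟩ := exists_weight_bound w
  have hmem : monomial (edgeVector i j (w i j) 0 B) (1 : K) ∈ I :=
    (hI _).2 (isWeightedCover_edgeVector hB (.inl le_rfl))
  have hnot : ∀ x, x < w i j → ¬ (v i ≤ w i j → v i ≤ x) := by
    intro x hx hvx
    have h1 := (hI _).1 (key _ (edgeVector i j x 0 B) hmem fun l hl => by
      simp only [edgeVector_apply] at hl ⊢
      by_cases hli : l = i
      · subst hli
        simp only [if_true] at hl ⊢
        exact hvx hl
      · simpa only [hli, if_false] using hl) i j hij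
    have h2 := hw j i hij.symm
    simp only [edgeVector_apply, if_true, hij.ne.symm, if_false] at h1
    omega
  have h1 := hnot (w i j - 1) (by have := hw i j hij; omega)
  omega

theorem isSimis_of_isBipartite
    (hmon : IsMonomialIdeal I) (hembedded : ∀ p, ¬ IsEmbeddedPrime I p)
    (hcard : ∀ A ∈ hypergraphEdges I, A.card = 2)
    (hw : ∀ i j, (associatedGraph I).Adj i j → 0 < w i j)
    (hI : ∀ m : Fin n →₀ ℕ, monomial m (1 : K) ∈ I ↔ IsWeightedCover (associatedGraph I) w m)
    {v : Fin n → ℕ} (hwv : ∀ i j, (associatedGraph I).Adj i j → w i j = v i)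
    (hG : (associatedGraph I).IsBipartite) : IsSimis I := by
  intro s _
  refine le_antisymm (fun f hf => mem_of_forall_monomial_mem fun m hm => ?_)
    (pow_le_symbolicPower I s)
  have hcov := isWeightedCoverOfOrder_of_mem_symbolicPower hmon hembedded hcard hw hI hf hm
  obtain ⟨c, hc, hcm⟩ := exists_covers_of_isBipartite (v := v) hG (s := s) (a := m) fun i j hij => by
    simpa only [hwv i j hij, hwv j i hij.symm] using hcov i j hij
  have hprod : ∏ k ∈ Finset.range s, monomial (Finsupp.equivFunOnFinite.symm (c k)) (1 : K) ∈
      I ^ s := by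
    have := Ideal.prod_mem_prod (ι := ℕ) (s := Finset.range s) (I := fun _ => I)
      (x := fun k => monomial (Finsupp.equivFunOnFinite.symm (c k)) (1 : K)) fun k hk =>
        (hI _).2 fun i j hij => by
          rw [hwv i j hij, hwv j i hij.symm]
          exact hc k hk i j hij
    simpa using this
  rw [← monomial_sum_one] at hprod
  refine monomial_mem_of_le (fun l => ?_) hprod
  simpa [Finsupp.finsetSum_apply] using hcm l

end Powers

end SimisIdeals

theorem mainTheorem5 {K : Type*} [Field K] {n : ℕ} (I : Ideal (MvPolynomial (Fin n) K))
    (hmon : SimisIdeals.IsMonomialIdeal I)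
    (hembedded : ∀ p : Ideal (MvPolynomial (Fin n) K), ¬ SimisIdeals.IsEmbeddedPrime I p)
    (hirr : SimisIdeals.HasMinimalIrreducibleDecomposition I)
    (hheight : ∀ p ∈ associatedPrimes (MvPolynomial (Fin n) K) (MvPolynomial (Fin n) K ⧸ I),
      p.height = 2) :
    (∀ A ∈ SimisIdeals.hypergraphEdges I, A.card = 2) ∧
    List.TFAE [
      SimisIdeals.IsSimis I,
      SimisIdeals.symbolicPower I 2 = I ^ 2,
      (SimisIdeals.associatedGraph I).IsBipartite ∧ SimisIdeals.HasStandardLinearWeighting I] := by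
  have hcard : ∀ A ∈ SimisIdeals.hypergraphEdges I, A.card = 2 := fun A hA =>
    SimisIdeals.card_eq_of_mem_hypergraphEdges (by exact_mod_cast hheight) hA
  obtain ⟨w, hw, hI⟩ := SimisIdeals.exists_edge_weights hmon hembedded hirr hcard
  refine ⟨hcard, ?_⟩
  tfae_have 1 → 2 := fun h => h 2 one_le_two
  tfae_have 2 → 3 := by
    intro h
    have hsplit := SimisIdeals.coversSplit_of_symbolicPower_two_eq hmon hembedded hcard hI h
    obtain ⟨v, hv, hwv⟩ := hsplit.exists_vertex_weight hw
    have hcov : ∀ c, SimisIdeals.IsWeightedCover (SimisIdeals.associatedGraph I) w c ↔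
        SimisIdeals.IsWeightedCover (SimisIdeals.associatedGraph I) (fun i _ => v i) c :=
      fun c => forall₃_congr fun i j hij => by rw [hwv i j hij, hwv j i hij.symm]
    refine ⟨SimisIdeals.CoversSplit.isBipartite hv fun a ha => ?_,
      SimisIdeals.hasStandardLinearWeighting_of_vertex_weights hmon hv
        fun m => (hI m).trans (hcov m)⟩
    simp only [← hcov]
    exact hsplit a fun i j hij => by
      rw [hwv i j hij, hwv j i hij.symm]
      exact ha i j hij
  tfae_have 3 → 1 := by
    rintro ⟨hG, hlin⟩
    obtain ⟨v, hwv⟩ :=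
      SimisIdeals.exists_vertex_weights_of_hasStandardLinearWeighting hw hI hlin
    exact SimisIdeals.isSimis_of_isBipartite hmon hembedded hcard hw hI hwv hG
  tfae_finish
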